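/- Let $n\ge 1$, and write $B_R(x_0)$ for the open ball in $\mathbb{R}^n$ with the Euclidean norm and $B_R=B_R(0)$. Let $C^{1,1}(B_1)$ be the space of differentiable functions $b:B_1\to\mathbb{R}$ with finite norm $\|b\|_{C^2}:=\sup_{B_1}|b|+\sup_{B_1}|\nabla b|+\mathrm{Lip}_{B_1}(\nabla b)$, where $\mathrm{Lip}_{B_1}(\nabla b)$ is the Lipschitz constant of $\nabla b$ on $B_1$, i.e. the essential supremum of $|\nabla^2 b|$ (operator norm). For $b_0,b_1\in C^{1,1}(B_1)$ set $b_{10}:=b_1-b_0$, let $$b_{\mathrm{env}}:=\sup\{f : f \text{ subharmonic on } B_1,\ f\le\min\{b_0,b_1\}\}$$ (pointwise supremum) be the subharmonic envelope, and let $\Lambda:=\{x\in B_1 : b_{\mathrm{env}}(x)=\min\{b_0,b_1\}(x)\}$ be its contact set. Then there is a constant $C(n)>0$ depending only on $n$ such that for all $b_0,b_1\in C^{1,1}(B_1)$, with $$C:=\frac{C(n)}{1+\|b_0\|_{C^2}+\|b_1\|_{C^2}},$$ one has for every $x_0\in B_{1/2}$ with $b_{10}(x_0)=0$ $$\Lambda\cap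 B_{C|\nabla b_{10}(x_0)|}(x_0)=\emptyset .$$ -/

import Mathlib

open Metric
open scoped ENNReal

noncomputable section

namespace Rooftop

/-- The `C²` norm on a convex open set `Ω ⊆ ℝⁿ` in its `C^{1,1}` form:
`sup |b| + sup |∇b| + Lip (∇b)`, with values in `[0, ∞]`. On a convex open set the Lipschitz
constant of `∇b` is the (essential) supremum of the operator norm of the second derivative `∇²b`.
(The quotient is `0 / 0 = 0` for `x = y`.) -/
def c2Norm {n : ℕ} (Ω : Set (EuclideanSpace ℝ (Fin n))) (b : EuclideanSpace ℝ (Fin n) → ℝ) :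
    ℝ≥0∞ :=
  (⨆ x ∈ Ω, ‖b x‖ₑ) + (⨆ x ∈ Ω, ‖gradient b x‖ₑ) +
    ⨆ x ∈ Ω, ⨆ y ∈ Ω, edist (gradient b x) (gradient b y) / edist x y

/-- `b ∈ C^{1,1}(Ω)`, for `Ω` open and convex: `b` is differentiable on `Ω` and its `C²` norm
is finite. -/
def IsC11On {n : ℕ} (Ω : Set (EuclideanSpace ℝ (Fin n))) (b : EuclideanSpace ℝ (Fin n) → ℝ) :
    Prop :=
  DifferentiableOn ℝ b Ω ∧ c2Norm Ω b ≠ ⊤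

/-- Subharmonic functions `f : Ω → [-∞, ∞)` on a connected open set `Ω ⊆ ℝⁿ`: `f` is upper
semicontinuous, not identically `-∞`, and on every closed ball contained in `Ω` it lies below
every function that is continuous on the closed ball, harmonic in its interior, and at least `f`
on the boundary sphere. -/
structure IsSubharmonicOn {n : ℕ} (Ω : Set (EuclideanSpace ℝ (Fin n)))
    (f : EuclideanSpace ℝ (Fin n) → EReal) : Prop where
  upperSemicontinuousOn : UpperSemicontinuousOn f Ω
  lt_top : ∀ x ∈ Ω, f x < ⊤
  exists_ne_bot : ∃ x ∈ Ω, f x ≠ ⊥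
  le_harmonic : ∀ (c : EuclideanSpace ℝ (Fin n)) (r : ℝ), 0 < r → closedBall c r ⊆ Ω →
    ∀ h : EuclideanSpace ℝ (Fin n) → ℝ, ContinuousOn h (closedBall c r) →
      InnerProductSpace.HarmonicOnNhd h (ball c r) →
      (∀ x ∈ sphere c r, f x ≤ (h x : EReal)) → ∀ x ∈ closedBall c r, f x ≤ (h x : EReal)

/-- The subharmonic envelope on `Ω` of the rooftop obstacle `min {b₀, b₁}`: the pointwise supremum
of all subharmonic functions on `Ω` that lie below `min {b₀, b₁}` on `Ω`. -/
def envelope {n : ℕ} (Ω : Set (EuclideanSpace ℝ (Fin n)))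
    (b₀ b₁ : EuclideanSpace ℝ (Fin n) → ℝ) (x : EuclideanSpace ℝ (Fin n)) : EReal :=
  sSup {t : EReal | ∃ f : EuclideanSpace ℝ (Fin n) → EReal,
    IsSubharmonicOn Ω f ∧ (∀ y ∈ Ω, f y ≤ ((min (b₀ y) (b₁ y) : ℝ) : EReal)) ∧ t = f x}

/-- The contact set of the envelope with the rooftop obstacle `min {b₀, b₁}`. -/
def contactSet {n : ℕ} (Ω : Set (EuclideanSpace ℝ (Fin n)))
    (b₀ b₁ : EuclideanSpace ℝ (Fin n) → ℝ) : Set (EuclideanSpace ℝ (Fin n)) :=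
  {x | x ∈ Ω ∧ envelope Ω b₀ b₁ x = ((min (b₀ x) (b₁ x) : ℝ) : EReal)}

end Rooftop

end

/-
At a point `x₀` of the edge `{b₀ = b₁}` the rooftop `min {b₀, b₁}` is, up to an error `N ‖x - x₀‖²`,
the minimum of two affine functions, and the slopes of these differ by `p = ∇(b₁ - b₀)(x₀)`. On the
sphere of radius `r` about `x₀` this minimum lies below a harmonic quadratic polynomial, which at
distance at most `r / (4n)` from `x₀` is smaller than the minimum by `‖p‖ r / (4n)`. The envelope is
below the polynomial raised by `N r²`. For `r` a small multiple of `‖p‖ / (1 + N)` the gain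
`‖p‖ r / (4n)` beats the errors, so the envelope stays strictly below the rooftop near `x₀`.
-/

namespace Rooftop

open Module InnerProductSpace Laplacian
open scoped RealInnerProductSpace

section Taylor

variable {F : Type*} [NormedAddCommGroup F] [InnerProductSpace ℝ F] [CompleteSpace F]

lemma abs_sub_sub_inner_gradient_le {f : F → ℝ} {s : Set F} {K : NNReal}
    (hf : ∀ z ∈ s, DifferentiableAt ℝ f z) (hK : LipschitzOnWith K (gradient f) s)
    (hs : Convex ℝ s) {x y : F} (hx : x ∈ s) (hy : y ∈ s) :
    |f y - f x - ⟪gradient f x, y - x⟫| ≤ K * ‖y - x‖ ^ 2 := by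
  have hbound : ∀ z ∈ s ∩ closedBall x ‖y - x‖,
      ‖fderiv ℝ f z - fderiv ℝ f x‖ ≤ K * ‖y - x‖ := fun z hz => by
    rw [← toDual_gradient, ← toDual_gradient, ← map_sub, LinearIsometryEquiv.norm_map,
      ← dist_eq_norm]
    exact (hK.dist_le_mul z hz.1 x hx).trans
      (mul_le_mul_of_nonneg_left (mem_closedBall.1 hz.2) K.coe_nonneg)
  have hmean := (hs.inter (convex_closedBall x ‖y - x‖)).norm_image_sub_le_of_norm_fderiv_le'
    (fun z hz => hf z hz.1) hbound ⟨hx, by simp⟩ ⟨hy, by simp [dist_eq_norm]⟩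
  rwa [← inner_gradient_left, Real.norm_eq_abs, mul_assoc, ← sq] at hmean

lemma gradient_fun_sub {f g : F → ℝ} {x : F} (hf : DifferentiableAt ℝ f x)
    (hg : DifferentiableAt ℝ g x) :
    gradient (fun y => f y - g y) x = gradient f x - gradient g x := by
  simp only [gradient, fderiv_fun_sub hf hg, map_sub]

end Taylor

section Harmonic

variable {E : Type*} [NormedAddCommGroup E] [InnerProductSpace ℝ E]

lemma hasFDerivAt_inner_sub (p x₀ x : E) :
    HasFDerivAt (fun y => ⟪p, y - x₀⟫) (innerSL ℝ p) x :=
  (innerSL ℝ p).hasFDerivAt.comp x ((hasFDerivAt_id x).sub_const x₀)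

variable [FiniteDimensional ℝ E]

lemma laplacian_eq_sum_of_hasFDerivAt {F ι : Type*} [NormedAddCommGroup F] [NormedSpace ℝ F]
    [Fintype ι] (v : OrthonormalBasis ι ℝ E) {f : E → F} {f' : E → E →L[ℝ] F}
    {f'' : E →L[ℝ] E →L[ℝ] F} {x : E} (hf : ∀ y, HasFDerivAt f (f' y) y)
    (hf' : HasFDerivAt f' f'' x) : Δ f x = ∑ i, f'' (v i) (v i) := by
  rw [laplacian_eq_iteratedFDeriv_orthonormalBasis f v]
  simp_rw [iteratedFDeriv_two_apply, funext fun y => (hf y).fderiv, hf'.fderiv]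
  rfl

lemma harmonicAt_inner_sub (p x₀ x : E) : HarmonicAt (fun y => ⟪p, y - x₀⟫) x := by
  refine ⟨contDiffAt_const.inner ℝ (contDiffAt_id.sub contDiffAt_const), .of_forall fun y => ?_⟩
  simp [laplacian_eq_sum_of_hasFDerivAt (stdOrthonormalBasis ℝ E) (hasFDerivAt_inner_sub p x₀)
    (hasFDerivAt_const (innerSL ℝ p) y)]

lemma laplacian_inner_sub_sq (p x₀ x : E) : Δ (fun y => ⟪p, y - x₀⟫ ^ 2) x = 2 * ‖p‖ ^ 2 := by
  have hf : ∀ y, HasFDerivAt (fun y => ⟪p, y - x₀⟫ ^ 2)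
      ((2 * ⟪p, y - x₀⟫) • innerSL ℝ p) y := fun y => by
    simpa using (hasFDerivAt_inner_sub p x₀ y).pow 2
  have hf' := ((hasFDerivAt_inner_sub p x₀ x).const_mul 2).smul_const (innerSL ℝ p)
  rw [laplacian_eq_sum_of_hasFDerivAt (stdOrthonormalBasis ℝ E) hf hf',
    ← (stdOrthonormalBasis ℝ E).sum_sq_inner_left p, Finset.mul_sum]
  exact Finset.sum_congr rfl fun i _ => by
    simp only [ContinuousLinearMap.smulRight_apply, smul_apply, coe_innerSL_apply, smul_eq_mul]
    ring

lemma laplacian_norm_sub_sq (x₀ x : E) : Δ (fun y => ‖y - x₀‖ ^ 2) x = 2 * finrank ℝ E := by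
  have hsub : ∀ y, HasFDerivAt (fun y => y - x₀) (ContinuousLinearMap.id ℝ E) y :=
    fun y => (hasFDerivAt_id y).sub_const x₀
  have hf : ∀ y, HasFDerivAt (fun y => ‖y - x₀‖ ^ 2) ((2 : ℝ) • innerSL ℝ (y - x₀)) y :=
    fun y => by simpa [ofNat_smul_eq_nsmul] using (hsub y).norm_sq
  have hf' := ((innerSL ℝ : E →L[ℝ] E →L[ℝ] ℝ).hasFDerivAt.comp x (hsub x)).const_smul (2 : ℝ)
  rw [laplacian_eq_sum_of_hasFDerivAt (stdOrthonormalBasis ℝ E) hf hf']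
  have hdiag : ∀ i, ((2 : ℝ) • (innerSL ℝ : E →L[ℝ] E →L[ℝ] ℝ)) (stdOrthonormalBasis ℝ E i)
      (stdOrthonormalBasis ℝ E i) = 2 * ⟪stdOrthonormalBasis ℝ E i, stdOrthonormalBasis ℝ E i⟫ :=
    fun _ => rfl
  refine (Finset.sum_congr rfl fun i _ => hdiag i).trans ?_
  simp [mul_comm]

lemma harmonicAt_norm_sq_mul_sub_finrank_mul_inner_sq (p x₀ x : E) :
    HarmonicAt (fun y => ‖p‖ ^ 2 * ‖y - x₀‖ ^ 2 - finrank ℝ E * ⟪p, y - x₀⟫ ^ 2) x := by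
  have hsub : ∀ y, ContDiffAt ℝ 2 (fun y => y - x₀) y :=
    fun y => contDiffAt_id.sub contDiffAt_const
  have hnorm : ∀ y, ContDiffAt ℝ 2 (fun y => ‖y - x₀‖ ^ 2) y := fun y => (hsub y).norm_sq ℝ
  have hinner : ∀ y, ContDiffAt ℝ 2 (fun y => ⟪p, y - x₀⟫ ^ 2) y :=
    fun y => (contDiffAt_const.inner ℝ (hsub y)).pow 2
  refine ⟨((hnorm x).const_smul (‖p‖ ^ 2)).sub ((hinner x).const_smul (finrank ℝ E : ℝ)),
    .of_forall fun y => ?_⟩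
  calc Δ (fun y => ‖p‖ ^ 2 * ‖y - x₀‖ ^ 2 - finrank ℝ E * ⟪p, y - x₀⟫ ^ 2) y
    _ = ‖p‖ ^ 2 * Δ (fun y => ‖y - x₀‖ ^ 2) y -
          finrank ℝ E * Δ (fun y => ⟪p, y - x₀⟫ ^ 2) y := by
        rw [← smul_eq_mul, ← smul_eq_mul, ← laplacian_smul _ (hnorm y),
          ← laplacian_smul _ (hinner y)]
        exact ((hnorm y).const_smul (‖p‖ ^ 2)).laplacian_sub
          ((hinner y).const_smul (finrank ℝ E : ℝ))
    _ = 0 := by rw [laplacian_norm_sub_sq, laplacian_inner_sub_sq]; ring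

end Harmonic

section LinearRooftop

variable {E : Type*} [NormedAddCommGroup E] [InnerProductSpace ℝ E]

lemma min_inner_eq (a₀ a₁ ξ : E) :
    min ⟪a₀, ξ⟫ ⟪a₁, ξ⟫ = (⟪a₀, ξ⟫ + ⟪a₁, ξ⟫) / 2 - |⟪a₁ - a₀, ξ⟫| / 2 := by
  rw [inner_sub_left]
  linarith [min_add_max ⟪a₀, ξ⟫ ⟪a₁, ξ⟫, max_sub_min_eq_abs ⟪a₀, ξ⟫ ⟪a₁, ξ⟫]

lemma abs_min_sub_add_min_inner_le {b₀ b₁ : E → ℝ} {a₀ a₁ x₀ x : E} {N : ℝ} (hx₀ : b₁ x₀ = b₀ x₀)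
    (h₀ : |b₀ x - b₀ x₀ - ⟪a₀, x - x₀⟫| ≤ N * ‖x - x₀‖ ^ 2)
    (h₁ : |b₁ x - b₁ x₀ - ⟪a₁, x - x₀⟫| ≤ N * ‖x - x₀‖ ^ 2) :
    |min (b₀ x) (b₁ x) - (b₀ x₀ + min ⟪a₀, x - x₀⟫ ⟪a₁, x - x₀⟫)| ≤ N * ‖x - x₀‖ ^ 2 := by
  rw [← min_add_add_left]
  refine (abs_min_sub_min_le_max _ _ _ _).trans (max_le ?_ ?_)
  · rwa [← sub_sub]
  · rwa [← sub_sub, ← hx₀]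

variable [FiniteDimensional ℝ E]

lemma one_le_finrank_of_ne {a₀ a₁ : E} (ha : a₀ ≠ a₁) : (1 : ℝ) ≤ finrank ℝ E := by
  have : Nontrivial E := ⟨a₀, a₁, ha⟩
  exact_mod_cast finrank_pos (R := ℝ) (M := E)

/-- A harmonic majorant, on the sphere `‖ξ‖ = r`, of the linear rooftop `min ⟪a₀, ξ⟫ ⟪a₁, ξ⟫`.
With `p = a₁ - a₀` the rooftop is `(⟪a₀, ξ⟫ + ⟪a₁, ξ⟫) / 2 - |⟪p, ξ⟫| / 2`. The majorant has
`⟪p, ξ⟫ ^ 2 / (‖p‖ * r)`, which is at most `|⟪p, ξ⟫|` for `‖ξ‖ = r`, in place of `|⟪p, ξ⟫|`, and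
compensates the Laplacian of this term by a multiple of `‖ξ‖ ^ 2 - r ^ 2`. -/
noncomputable def rooftopMajorant (a₀ a₁ : E) (r : ℝ) (ξ : E) : ℝ :=
  (⟪a₀, ξ⟫ + ⟪a₁, ξ⟫) / 2 +
    (‖a₁ - a₀‖ ^ 2 * (‖ξ‖ ^ 2 - r ^ 2) - finrank ℝ E * ⟪a₁ - a₀, ξ⟫ ^ 2) /
      (2 * finrank ℝ E * ‖a₁ - a₀‖ * r)

lemma harmonicAt_rooftopMajorant (a₀ a₁ : E) (r : ℝ) (x₀ x : E) :
    HarmonicAt (fun y => rooftopMajorant a₀ a₁ r (y - x₀)) x := by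
  set p := a₁ - a₀ with hp
  set c := 2 * finrank ℝ E * ‖p‖ * r with hc
  have haffine := ((harmonicAt_inner_sub a₀ x₀ x).add (harmonicAt_inner_sub a₁ x₀ x)).const_smul
    (c := (1 / 2 : ℝ))
  have hquadratic := ((harmonicAt_norm_sq_mul_sub_finrank_mul_inner_sq p x₀ x).sub
    (harmonicAt_const (‖p‖ ^ 2 * r ^ 2))).const_smul (c := c⁻¹)
  convert haffine.add hquadratic using 1
  funext y
  simp only [rooftopMajorant, ← hp, ← hc, Pi.add_apply, Pi.sub_apply, Pi.smul_apply, smul_eq_mul]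
  ring

lemma min_inner_le_rooftopMajorant {a₀ a₁ ξ : E} (ha : a₀ ≠ a₁) (hξ : ξ ≠ 0) :
    min ⟪a₀, ξ⟫ ⟪a₁, ξ⟫ ≤ rooftopMajorant a₀ a₁ ‖ξ‖ ξ := by
  have hp : 0 < ‖a₁ - a₀‖ := norm_pos_iff.2 (sub_ne_zero.2 ha.symm)
  have hn := one_le_finrank_of_ne ha
  have hs : |⟪a₁ - a₀, ξ⟫| ≤ ‖a₁ - a₀‖ * ‖ξ‖ := abs_real_inner_le_norm _ _
  have hparabola : ⟪a₁ - a₀, ξ⟫ ^ 2 / (‖a₁ - a₀‖ * ‖ξ‖) ≤ |⟪a₁ - a₀, ξ⟫| := by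
    rw [div_le_iff₀ (by positivity), ← sq_abs, sq]
    exact mul_le_mul_of_nonneg_left hs (abs_nonneg _)
  calc min ⟪a₀, ξ⟫ ⟪a₁, ξ⟫
    _ = (⟪a₀, ξ⟫ + ⟪a₁, ξ⟫) / 2 - |⟪a₁ - a₀, ξ⟫| / 2 := min_inner_eq a₀ a₁ ξ
    _ ≤ (⟪a₀, ξ⟫ + ⟪a₁, ξ⟫) / 2 - ⟪a₁ - a₀, ξ⟫ ^ 2 / (‖a₁ - a₀‖ * ‖ξ‖) / 2 := by linarith
    _ = rooftopMajorant a₀ a₁ ‖ξ‖ ξ := by rw [rooftopMajorant]; field_simp; ring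

lemma rooftopMajorant_le_min_inner_sub {a₀ a₁ ξ : E} {r : ℝ} (ha : a₀ ≠ a₁) (hr : 0 < r)
    (hξ : ‖ξ‖ ≤ r / (4 * finrank ℝ E)) :
    rooftopMajorant a₀ a₁ r ξ ≤
      min ⟪a₀, ξ⟫ ⟪a₁, ξ⟫ - ‖a₁ - a₀‖ * r / (4 * finrank ℝ E) := by
  have hp : 0 < ‖a₁ - a₀‖ := norm_pos_iff.2 (sub_ne_zero.2 ha.symm)
  have hn := one_le_finrank_of_ne ha
  have hs : |⟪a₁ - a₀, ξ⟫| ≤ ‖a₁ - a₀‖ * ‖ξ‖ := abs_real_inner_le_norm _ _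
  rw [min_inner_eq, rooftopMajorant]
  generalize (finrank ℝ E : ℝ) = n at *
  generalize ‖a₁ - a₀‖ = P at *
  generalize ⟪a₁ - a₀, ξ⟫ = s at *
  have hn₀ : 0 < n := by linarith
  have hnξ : n * ‖ξ‖ ≤ r / 4 := by
    rw [le_div_iff₀ (by positivity)] at hξ
    linarith
  have hξr : ‖ξ‖ ≤ r / 4 := (le_mul_of_one_le_left (norm_nonneg ξ) hn).trans hnξ
  have hedge : n * P * r * |s| ≤ P ^ 2 * r ^ 2 / 4 := by
    calc n * P * r * |s| ≤ n * P * r * (P * ‖ξ‖) := by gcongr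
      _ = P ^ 2 * r * (n * ‖ξ‖) := by ring
      _ ≤ P ^ 2 * r * (r / 4) := by gcongr
      _ = P ^ 2 * r ^ 2 / 4 := by ring
  have hsq : P ^ 2 * ‖ξ‖ ^ 2 ≤ P ^ 2 * (r / 4) ^ 2 := by gcongr
  have hquadratic : (P ^ 2 * (‖ξ‖ ^ 2 - r ^ 2) - n * s ^ 2) / (2 * n * P * r) ≤
      -(|s| / 2) - P * r / (4 * n) := by
    rw [div_le_iff₀ (by positivity)]
    have : (-(|s| / 2) - P * r / (4 * n)) * (2 * n * P * r) =
        -(n * P * r * |s|) - P ^ 2 * r ^ 2 / 2 := by field_simp; ring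
    nlinarith [mul_nonneg hn₀.le (sq_nonneg s), mul_nonneg (sq_nonneg P) (sq_nonneg r)]
  linarith

end LinearRooftop

section Envelope

variable {n : ℕ} {Ω : Set (EuclideanSpace ℝ (Fin n))} {b b₀ b₁ h : EuclideanSpace ℝ (Fin n) → ℝ}
  {x₀ a₀ a₁ x y : EuclideanSpace ℝ (Fin n)} {r N δ : ℝ}

lemma IsC11On.norm_gradient_le (hb : IsC11On Ω b) (hx : x ∈ Ω) :
    ‖gradient b x‖ ≤ (c2Norm Ω b).toReal := by
  have henorm : ‖gradient b x‖ₑ ≤ c2Norm Ω b :=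
    (le_iSup₂ (f := fun z (_ : z ∈ Ω) => ‖gradient b z‖ₑ) x hx).trans
      (le_add_self.trans le_self_add)
  simpa using ENNReal.toReal_mono hb.2 henorm

lemma IsC11On.lipschitzOnWith_gradient (hb : IsC11On Ω b) :
    LipschitzOnWith (c2Norm Ω b).toNNReal (gradient b) Ω := fun x hx y hy => by
  rw [ENNReal.coe_toNNReal hb.2]
  have hquotient : edist (gradient b x) (gradient b y) / edist x y ≤ c2Norm Ω b :=
    (le_iSup₂ (f := fun x (_ : x ∈ Ω) => ⨆ y ∈ Ω,
      edist (gradient b x) (gradient b y) / edist x y) x hx).trans' (le_iSup₂ (f := fun y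
        (_ : y ∈ Ω) => edist (gradient b x) (gradient b y) / edist x y) y hy) |>.trans le_add_self
  rcases eq_or_ne x y with rfl | hxy
  · simp
  · exact (ENNReal.div_le_iff (edist_pos.2 hxy).ne' (edist_ne_top x y)).1 hquotient

lemma IsC11On.differentiableAt_of_ball_subset (hb : IsC11On Ω b) (hΩ : ball x₀ δ ⊆ Ω)
    (hx : x ∈ ball x₀ δ) : DifferentiableAt ℝ b x :=
  hb.1.differentiableAt (Filter.mem_of_superset (isOpen_ball.mem_nhds hx) hΩ)

lemma IsC11On.abs_sub_sub_inner_gradient_le (hb : IsC11On Ω b) (hΩ : ball x₀ δ ⊆ Ω)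
    (hx : x ∈ ball x₀ δ) :
    |b x - b x₀ - ⟪gradient b x₀, x - x₀⟫| ≤ (c2Norm Ω b).toReal * ‖x - x₀‖ ^ 2 :=
  Rooftop.abs_sub_sub_inner_gradient_le (fun _ hz => hb.differentiableAt_of_ball_subset hΩ hz)
    (hb.lipschitzOnWith_gradient.mono hΩ) (convex_ball x₀ δ)
    (mem_ball_self (dist_nonneg.trans_lt hx)) hx

lemma envelope_le_of_harmonicOnNhd (hr : 0 < r) (hΩ : closedBall x₀ r ⊆ Ω)
    (hh : HarmonicOnNhd h (closedBall x₀ r))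
    (hb : ∀ x ∈ sphere x₀ r, min (b₀ x) (b₁ x) ≤ h x) (hy : y ∈ closedBall x₀ r) :
    envelope Ω b₀ b₁ y ≤ h y := by
  refine sSup_le ?_
  rintro _ ⟨f, hf, hfb, rfl⟩
  exact hf.le_harmonic x₀ r hr hΩ h hh.continuousOn (hh.mono ball_subset_closedBall)
    (fun x hx => (hfb x (hΩ (sphere_subset_closedBall hx))).trans
      (EReal.coe_le_coe_iff.2 (hb x hx))) y hy

theorem disjoint_contactSet_ball_of_abs_sub_sub_inner_le (ha : a₀ ≠ a₁) (hr : 0 < r)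
    (hΩ : closedBall x₀ r ⊆ Ω) (hN : 8 * n * N * r ≤ ‖a₁ - a₀‖) (hx₀ : b₁ x₀ = b₀ x₀)
    (h₀ : ∀ x ∈ closedBall x₀ r, |b₀ x - b₀ x₀ - ⟪a₀, x - x₀⟫| ≤ N * ‖x - x₀‖ ^ 2)
    (h₁ : ∀ x ∈ closedBall x₀ r, |b₁ x - b₁ x₀ - ⟪a₁, x - x₀⟫| ≤ N * ‖x - x₀‖ ^ 2) :
    Disjoint (contactSet Ω b₀ b₁) (ball x₀ (r / (4 * n))) := by
  have hn : (1 : ℝ) ≤ n := by simpa using one_le_finrank_of_ne ha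
  have hp : 0 < ‖a₁ - a₀‖ := norm_pos_iff.2 (sub_ne_zero.2 ha.symm)
  have hrooftop := fun x hx => abs_le.1 (abs_min_sub_add_min_inner_le hx₀ (h₀ x hx) (h₁ x hx))
  rw [Set.disjoint_left]
  rintro y ⟨-, hcontact⟩ hy
  rw [mem_ball, dist_eq_norm] at hy
  have hyr : ‖y - x₀‖ < r := hy.trans_le (div_le_self hr.le (by linarith))
  have hyball : y ∈ closedBall x₀ r := by simpa [dist_eq_norm] using hyr.le
  have hharmonic : HarmonicOnNhd
      (fun x => b₀ x₀ + N * r ^ 2 + rooftopMajorant a₀ a₁ r (x - x₀)) (closedBall x₀ r) :=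
    fun x _ => (harmonicAt_const _).add (harmonicAt_rooftopMajorant a₀ a₁ r x₀ x)
  have hsphere : ∀ x ∈ sphere x₀ r,
      min (b₀ x) (b₁ x) ≤ b₀ x₀ + N * r ^ 2 + rooftopMajorant a₀ a₁ r (x - x₀) := by
    intro x hx
    obtain rfl : ‖x - x₀‖ = r := by rwa [← dist_eq_norm]
    linarith [(hrooftop x (sphere_subset_closedBall hx)).2,
      min_inner_le_rooftopMajorant ha (norm_pos_iff.1 hr)]
  have henvelope := envelope_le_of_harmonicOnNhd hr hΩ hharmonic hsphere hyball
  rw [hcontact, EReal.coe_le_coe_iff] at henvelope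
  have hgain := rooftopMajorant_le_min_inner_sub ha hr (by simpa using hy.le)
  rw [finrank_euclideanSpace_fin] at hgain
  have herror : N * (r ^ 2 + ‖y - x₀‖ ^ 2) < ‖a₁ - a₀‖ * r / (4 * n) := by
    have hNr : N ≤ ‖a₁ - a₀‖ / (8 * n * r) := by
      rw [le_div_iff₀ (by positivity)]
      linarith
    calc N * (r ^ 2 + ‖y - x₀‖ ^ 2)
      _ ≤ ‖a₁ - a₀‖ / (8 * n * r) * (r ^ 2 + ‖y - x₀‖ ^ 2) := by gcongr
      _ < ‖a₁ - a₀‖ / (8 * n * r) * (r ^ 2 + r ^ 2) := by gcongr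
      _ = ‖a₁ - a₀‖ * r / (4 * n) := by field_simp; ring
  linarith [(hrooftop y hyball).1]

theorem IsC11On.disjoint_contactSet_ball (hb₀ : IsC11On Ω b₀) (hb₁ : IsC11On Ω b₁)
    (hr₀ : 0 < r) (hrδ : r < δ) (hΩ : ball x₀ δ ⊆ Ω) (hx₀ : b₁ x₀ = b₀ x₀)
    (hne : gradient b₀ x₀ ≠ gradient b₁ x₀)
    (hr : 8 * n * ((c2Norm Ω b₀).toReal + (c2Norm Ω b₁).toReal) * r ≤
      ‖gradient b₁ x₀ - gradient b₀ x₀‖) :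
    Disjoint (contactSet Ω b₀ b₁) (ball x₀ (r / (4 * n))) := by
  have hball : closedBall x₀ r ⊆ ball x₀ δ := closedBall_subset_ball hrδ
  refine disjoint_contactSet_ball_of_abs_sub_sub_inner_le hne hr₀ (hball.trans hΩ) hr hx₀
    (fun x hx => (hb₀.abs_sub_sub_inner_gradient_le hΩ (hball hx)).trans ?_)
    (fun x hx => (hb₁.abs_sub_sub_inner_gradient_le hΩ (hball hx)).trans ?_)
  · gcongr
    exact le_add_of_nonneg_right ENNReal.toReal_nonneg
  · gcongr
    exact le_add_of_nonneg_left ENNReal.toReal_nonneg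

end Envelope

end Rooftop

theorem proposition4p4_general {n : ℕ} {Ω : Set (EuclideanSpace ℝ (Fin n))}
    {b₀ b₁ : EuclideanSpace ℝ (Fin n) → ℝ} (hb₀ : Rooftop.IsC11On Ω b₀)
    (hb₁ : Rooftop.IsC11On Ω b₁) {x₀ : EuclideanSpace ℝ (Fin n)} {δ : ℝ} (hδ₀ : 0 < δ)
    (hδ₁ : δ ≤ 1) (hΩ : ball x₀ δ ⊆ Ω) (hx₀ : b₁ x₀ - b₀ x₀ = 0) :
    Rooftop.contactSet Ω b₀ b₁ ∩
      ball x₀ (δ / (32 * n ^ 2) /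
          (1 + (Rooftop.c2Norm Ω b₀).toReal + (Rooftop.c2Norm Ω b₁).toReal)
        * ‖gradient (fun x => b₁ x - b₀ x) x₀‖) = ∅ := by
  have hmem : x₀ ∈ ball x₀ δ := mem_ball_self hδ₀
  rw [Rooftop.gradient_fun_sub (hb₁.differentiableAt_of_ball_subset hΩ hmem)
    (hb₀.differentiableAt_of_ball_subset hΩ hmem)]
  obtain ha | ha := eq_or_ne (gradient b₀ x₀) (gradient b₁ x₀)
  · simp [ha]
  have hn : (1 : ℝ) ≤ n := by simpa using Rooftop.one_le_finrank_of_ne ha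
  have hp : 0 < ‖gradient b₁ x₀ - gradient b₀ x₀‖ := norm_pos_iff.2 (sub_ne_zero.2 ha.symm)
  have hpN := (norm_sub_le (gradient b₁ x₀) (gradient b₀ x₀)).trans
    (add_le_add (hb₁.norm_gradient_le (hΩ hmem)) (hb₀.norm_gradient_le (hΩ hmem)))
  set p := gradient b₁ x₀ - gradient b₀ x₀
  set N₀ := (Rooftop.c2Norm Ω b₀).toReal
  set N₁ := (Rooftop.c2Norm Ω b₁).toReal
  have hN₀ : 0 ≤ N₀ := ENNReal.toReal_nonneg
  have hN₁ : 0 ≤ N₁ := ENNReal.toReal_nonneg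
  set r := δ * ‖p‖ / (8 * n * (1 + N₀ + N₁)) with hr
  have hrδ : r < δ := by
    rw [hr, div_lt_iff₀ (by positivity)]
    gcongr
    nlinarith
  have hrp : 8 * n * (N₀ + N₁) * r ≤ ‖p‖ :=
    calc 8 * n * (N₀ + N₁) * r ≤ 8 * n * (1 + N₀ + N₁) * r := by gcongr; linarith
      _ = δ * ‖p‖ := by rw [hr]; field_simp
      _ ≤ ‖p‖ := mul_le_of_le_one_left hp.le hδ₁
  have hradius : δ / (32 * n ^ 2) / (1 + N₀ + N₁) * ‖p‖ = r / (4 * n) := by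
    rw [hr]; field_simp; norm_num
  rw [hradius, ← Set.disjoint_iff_inter_eq_empty]
  exact hb₀.disjoint_contactSet_ball hb₁ (by positivity) hrδ hΩ
    (sub_eq_zero.1 hx₀) ha hrp

theorem proposition4p4 (n : ℕ) (hn : 1 ≤ n) :
    ∃ C : ℝ, 0 < C ∧
      ∀ b₀ b₁ : EuclideanSpace ℝ (Fin n) → ℝ,
        Rooftop.IsC11On (ball 0 1) b₀ → Rooftop.IsC11On (ball 0 1) b₁ →
        ∀ x₀ ∈ ball (0 : EuclideanSpace ℝ (Fin n)) (1 / 2), b₁ x₀ - b₀ x₀ = 0 →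
          Rooftop.contactSet (ball 0 1) b₀ b₁ ∩
            ball x₀ (C / (1 + (Rooftop.c2Norm (ball 0 1) b₀).toReal
                + (Rooftop.c2Norm (ball 0 1) b₁).toReal)
              * ‖gradient (fun x => b₁ x - b₀ x) x₀‖) = ∅ := by
  refine ⟨1 / 2 / (32 * n ^ 2), by positivity, fun b₀ b₁ hb₀ hb₁ x₀ hx₀ hedge => ?_⟩
  have hball : ball x₀ (1 / 2) ⊆ ball 0 1 := ball_subset_ball' (by linarith [mem_ball.1 hx₀])
  exact proposition4p4_general hb₀ hb₁ (by norm_num) (by norm_num) hball hedge
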